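/- Let $k$ be a field and $q\in k$, $q\neq 0$. Let $A=\mathcal O_q(SU(2))$ be the unital $k$-algebra generated by $\alpha,\gamma,\alpha^*,\gamma^*$ with relations $$\alpha\gamma=q\gamma\alpha,\quad \alpha\gamma^*=q\gamma^*\alpha,\quad \gamma^*\alpha^*=q\alpha^*\gamma^*,\quad \gamma\alpha^*=q\alpha^*\gamma,\quad \gamma\gamma^*=\gamma^*\gamma,\quad \alpha^*\alpha+\gamma^*\gamma=1,\quad \alpha\alpha^*+q^2\gamma\gamma^*=1$$ (for $k=\mathbb C$ and $q$ real this is the algebra underlying the usual $*$-algebra). Let $H=\mathcal O(U(1))=k[t,t^{-1}]$ with $t$ group-like, and let $\delta:A\to A\otimes H$ be the right coaction that is the algebra map with $\delta(\alpha)=\alpha\otimes t$, $\delta(\gamma)=\gamma\otimes t$, $\delta(\alpha^*)=\alpha^*\otimes t^{-1}$, $\delta(\gamma^*)=\gamma^*\otimes t^{-1}$. Let $A_n=\{a\in A:\delta(a)=a\otimes t^n\}$ for $n\in\mathbb Z$, and let $B=A^{\mathrm{co}H}=A_0=\mathcal O_q(S^2)$ be the standard Podleś sphere. Then the inclusion $\mathcal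 O_q(S^2)\subset\mathcal O_q(SU(2))$ defines a principal right $\mathcal O(U(1))$-comodule algebra: the antipode of $H$ is bijective, the canonical map $A\otimes_BA\to A\otimes H$, $a\otimes_B a'\mapsto a\,\delta(a')$, is bijective, and the multiplication map $\mu:B\otimes A\to A$ has a left $B$-linear, right $H$-colinear splitting $s:A\to B\otimes A$ with $\mu\circ s=\mathrm{id}_A$. Moreover, $A=\bigoplus_{n\in\mathbb Z}A_n$ is a strong grading, i.e. $A_mA_n=A_{m+n}$ for all $m,n\in\mathbb Z$, and the splitting can be taken to come from this grading: there is a splitting $s$ as above such that for every $n\in\mathbb Z$ there are finitely many $x_i\in A_{-n}$, $y_i\in A_n$ with $\sum_i x_iy_i=1$ and $s(a)=\sum_i a x_i\otimes y_i$ for all $a\in A_n$. -/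

import Mathlib

open scoped TensorProduct LaurentPolynomial

noncomputable section

/-! ### Right comodule algebras, Hopf-Galois extensions, principality -/

/-- The structure of a right `H`-comodule algebra on `A`: an algebra map `δ : A → A ⊗ H` which is
coassociative and counital. -/
structure RightCoaction (k A H : Type*) [Field k] [Ring A] [Algebra k A] [Ring H]
    [HopfAlgebra k H] where
  /-- the coaction `a ↦ a₍₀₎ ⊗ a₍₁₎` -/
  δ : A →ₐ[k] A ⊗[k] H
  /-- `(δ ⊗ id) ∘ δ = (id ⊗ Δ) ∘ δ` -/
  coassoc : (TensorProduct.assoc k A H H).toLinearMap ∘ₗ δ.toLinearMap.rTensor H ∘ₗ δ.toLinearMap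
    = (Coalgebra.comul (R := k) (A := H)).lTensor A ∘ₗ δ.toLinearMap
  /-- `(id ⊗ ε) ∘ δ = id` -/
  counit : (TensorProduct.rid k A).toLinearMap ∘ₗ (Coalgebra.counit (R := k) (A := H)).lTensor A
    ∘ₗ δ.toLinearMap = LinearMap.id

namespace RightCoaction

variable {k A H : Type*} [Field k] [Ring A] [Algebra k A] [Ring H] [HopfAlgebra k H]

/-- The subalgebra of coinvariants `B = {b ∈ A | δ b = b ⊗ 1}`. -/
def coinvariants (c : RightCoaction k A H) : Subalgebra k A :=
  AlgHom.equalizer c.δ Algebra.TensorProduct.includeLeft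

theorem mem_coinvariants (c : RightCoaction k A H) (b : A) :
    b ∈ c.coinvariants ↔ c.δ b = b ⊗ₜ[k] (1 : H) := Iff.rfl

/-- The kernel of `A ⊗ A → A ⊗_B A`, spanned by all `a b ⊗ a' - a ⊗ b a'` with `b ∈ B`. -/
def balancedRelations (B : Subalgebra k A) : Submodule k (A ⊗[k] A) :=
  Submodule.span k {z | ∃ (a a' : A) (b : B),
    z = (a * (b : A)) ⊗ₜ[k] a' - a ⊗ₜ[k] ((b : A) * a')}

/-- The balanced tensor product `A ⊗_B A` over a (not necessarily commutative) subalgebra `B`. -/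
abbrev BalancedTensor (B : Subalgebra k A) : Type _ := (A ⊗[k] A) ⧸ balancedRelations B

/-- The lifted canonical map `A ⊗ A → A ⊗ H`, `a ⊗ a' ↦ a δ(a')`. -/
def canLift (c : RightCoaction k A H) : A ⊗[k] A →ₗ[k] A ⊗[k] H :=
  TensorProduct.lift ((LinearMap.mul k (A ⊗[k] H)).compl₁₂
    (Algebra.TensorProduct.includeLeft : A →ₐ[k] A ⊗[k] H).toLinearMap c.δ.toLinearMap)

theorem canLift_tmul (c : RightCoaction k A H) (a a' : A) :
    c.canLift (a ⊗ₜ[k] a') = (a ⊗ₜ[k] (1 : H)) * c.δ a' := by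
  simp [canLift]

theorem balancedRelations_le_ker (c : RightCoaction k A H) :
    balancedRelations c.coinvariants ≤ LinearMap.ker c.canLift := by
  refine Submodule.span_le.2 ?_
  rintro _ ⟨a, a', b, rfl⟩
  have hb := (c.mem_coinvariants _).1 b.2
  simp [canLift_tmul, hb, ← mul_assoc]

/-- The canonical map `can : A ⊗_B A → A ⊗ H`, `a ⊗_B a' ↦ a δ(a')`. -/
def can (c : RightCoaction k A H) : BalancedTensor c.coinvariants →ₗ[k] A ⊗[k] H :=
  (balancedRelations c.coinvariants).liftQ c.canLift c.balancedRelations_le_ker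

/-- `B ⊂ A` is a Hopf-Galois extension. -/
def IsHopfGalois (c : RightCoaction k A H) : Prop := Function.Bijective c.can

/-- The multiplication map `μ : B ⊗ A → A`. -/
def mulMap (c : RightCoaction k A H) : c.coinvariants ⊗[k] A →ₗ[k] A :=
  TensorProduct.lift ((LinearMap.mul k A).domRestrict c.coinvariants.toSubmodule)

/-- `s : A → B ⊗ A` is a left `B`-linear, right `H`-colinear splitting of `μ : B ⊗ A → A`. -/
structure IsSplitting (c : RightCoaction k A H) (s : A →ₗ[k] c.coinvariants ⊗[k] A) : Prop where
  /-- left `B`-linearity, `B` acting on the left tensor factor of `B ⊗ A` -/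
  left_linear : ∀ (b : c.coinvariants) (a : A), s ((b : A) * a) = b • s a
  /-- `(id ⊗ δ) ∘ s = (s ⊗ id) ∘ δ` -/
  right_colinear : c.δ.toLinearMap.lTensor c.coinvariants ∘ₗ s
    = (TensorProduct.assoc k c.coinvariants A H).toLinearMap ∘ₗ s.rTensor H ∘ₗ c.δ.toLinearMap
  /-- `μ ∘ s = id` -/
  mul_comp : c.mulMap ∘ₗ s = LinearMap.id

/-- `A` is a principal right `H`-comodule algebra. -/
structure IsPrincipal (c : RightCoaction k A H) : Prop where
  antipode_bijective : Function.Bijective (HopfAlgebra.antipode k : H →ₗ[k] H)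
  hopfGalois : c.IsHopfGalois
  exists_splitting : ∃ s : A →ₗ[k] c.coinvariants ⊗[k] A, c.IsSplitting s

/-- For a coaction of `k[t, t⁻¹]`, the degree `n` component `A_n = {a ∈ A | δ a = a ⊗ tⁿ}`. -/
def component (c : RightCoaction k A k[T;T⁻¹]) (n : ℤ) : Submodule k A :=
  LinearMap.eqLocus c.δ.toLinearMap ((TensorProduct.mk k A k[T;T⁻¹]).flip (LaurentPolynomial.T n))

theorem mem_component (c : RightCoaction k A k[T;T⁻¹]) (n : ℤ) (a : A) :
    a ∈ c.component n ↔ c.δ a = a ⊗ₜ[k] (LaurentPolynomial.T n : k[T;T⁻¹]) := Iff.rfl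

end RightCoaction

/-! ### The quantum group `SU_q(2)` and the `U(1)`-coaction -/

/-- The generators `α, γ, α*, γ*`. -/
inductive SUqGen : Type
  | a
  | c
  | aStar
  | cStar

namespace SUqGen

/-- The weights of the generators under the `U(1)`-coaction. -/
def weight : SUqGen → ℤ
  | a => 1
  | c => 1
  | aStar => -1
  | cStar => -1

end SUqGen

open SUqGen in
/-- The defining relations of `O_q(SU(2))`:
`αγ = qγα`, `αγ* = qγ*α`, their adjoints `γ*α* = qα*γ*`, `γα* = qα*γ`, and
`γγ* = γ*γ`, `α*α + γ*γ = 1`, `αα* + q²γγ* = 1`. -/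
inductive SUqRel {k : Type*} [Field k] (q : k) : FreeAlgebra k SUqGen → FreeAlgebra k SUqGen → Prop
  | a_c : SUqRel q (FreeAlgebra.ι k a * FreeAlgebra.ι k c)
      (q • (FreeAlgebra.ι k c * FreeAlgebra.ι k a))
  | a_cStar : SUqRel q (FreeAlgebra.ι k a * FreeAlgebra.ι k cStar)
      (q • (FreeAlgebra.ι k cStar * FreeAlgebra.ι k a))
  | cStar_aStar : SUqRel q (FreeAlgebra.ι k cStar * FreeAlgebra.ι k aStar)
      (q • (FreeAlgebra.ι k aStar * FreeAlgebra.ι k cStar))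
  | c_aStar : SUqRel q (FreeAlgebra.ι k c * FreeAlgebra.ι k aStar)
      (q • (FreeAlgebra.ι k aStar * FreeAlgebra.ι k c))
  | c_cStar : SUqRel q (FreeAlgebra.ι k c * FreeAlgebra.ι k cStar)
      (FreeAlgebra.ι k cStar * FreeAlgebra.ι k c)
  | sphere_left : SUqRel q
      (FreeAlgebra.ι k aStar * FreeAlgebra.ι k a + FreeAlgebra.ι k cStar * FreeAlgebra.ι k c) 1
  | sphere_right : SUqRel q
      (FreeAlgebra.ι k a * FreeAlgebra.ι k aStar
        + q ^ 2 • (FreeAlgebra.ι k c * FreeAlgebra.ι k cStar)) 1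

/-- The algebra `O_q(SU(2))`. -/
abbrev OqSU2 {k : Type*} [Field k] (q : k) : Type _ := RingQuot (SUqRel q)

namespace OqSU2

variable {k : Type*} [Field k] (q : k)

/-- The class of a generator in `O_q(SU(2))`. -/
def gen (x : SUqGen) : OqSU2 q := RingQuot.mkAlgHom k (SUqRel q) (FreeAlgebra.ι k x)

/-- The coaction on the free algebra, `x ↦ x ⊗ t^(weight x)` on generators. -/
def coactionFree : FreeAlgebra k SUqGen →ₐ[k] OqSU2 q ⊗[k] k[T;T⁻¹] :=
  FreeAlgebra.lift k fun x => gen q x ⊗ₜ[k] LaurentPolynomial.T x.weight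

theorem coactionFree_rel {x y : FreeAlgebra k SUqGen} (h : SUqRel q x y) :
    coactionFree q x = coactionFree q y := by
  have key := RingQuot.mkAlgHom_rel k h
  cases h <;>
    simp only [map_mul, map_add, map_smul, map_one] at key <;>
    simp only [coactionFree, map_mul, map_add, map_smul, map_one, FreeAlgebra.lift_ι_apply,
      Algebra.TensorProduct.tmul_mul_tmul, SUqGen.weight, ← LaurentPolynomial.T_add, gen,
      TensorProduct.smul_tmul', ← TensorProduct.add_tmul, key, neg_add_cancel, add_neg_cancel,
      LaurentPolynomial.T_zero, Algebra.TensorProduct.one_def]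

/-- The coaction map `δ : O_q(SU(2)) → O_q(SU(2)) ⊗ O(U(1))`, `δ α = α ⊗ t`, `δ γ = γ ⊗ t`,
`δ α* = α* ⊗ t⁻¹`, `δ γ* = γ* ⊗ t⁻¹`. -/
def coactionHom : OqSU2 q →ₐ[k] OqSU2 q ⊗[k] k[T;T⁻¹] :=
  RingQuot.liftAlgHom k ⟨coactionFree q, fun _ _ h => coactionFree_rel q h⟩

theorem coactionHom_gen (x : SUqGen) :
    coactionHom q (gen q x) = gen q x ⊗ₜ[k] LaurentPolynomial.T x.weight := by
  simp [coactionHom, gen, coactionFree]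

/-- The right `O(U(1))`-comodule algebra `O_q(SU(2))`, where `O(U(1)) = k[t, t⁻¹]` with `t`
group-like. Its coinvariants are the standard Podleś sphere `O_q(S²)`. -/
def coaction : RightCoaction k (OqSU2 q) k[T;T⁻¹] where
  δ := coactionHom q
  coassoc := by
    have h : (Algebra.TensorProduct.assoc k k k (OqSU2 q) k[T;T⁻¹] k[T;T⁻¹]).toAlgHom.comp
        ((Algebra.TensorProduct.map (coactionHom q) (AlgHom.id k k[T;T⁻¹])).comp (coactionHom q))
        = (Algebra.TensorProduct.map (AlgHom.id k (OqSU2 q))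
          (Bialgebra.comulAlgHom k k[T;T⁻¹])).comp (coactionHom q) := by
      apply RingQuot.ringQuot_ext'
      apply FreeAlgebra.hom_ext
      funext x
      change Algebra.TensorProduct.assoc k k k (OqSU2 q) k[T;T⁻¹] k[T;T⁻¹]
        (Algebra.TensorProduct.map (coactionHom q) (AlgHom.id k k[T;T⁻¹])
          (coactionHom q (gen q x))) = Algebra.TensorProduct.map (AlgHom.id k (OqSU2 q))
          (Bialgebra.comulAlgHom k k[T;T⁻¹]) (coactionHom q (gen q x))
      simp [coactionHom_gen]
    exact LinearMap.ext fun a => DFunLike.congr_fun h a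
  counit := by
    have h : (Algebra.TensorProduct.rid k k (OqSU2 q)).toAlgHom.comp
        ((Algebra.TensorProduct.map (AlgHom.id k (OqSU2 q))
          (Bialgebra.counitAlgHom k k[T;T⁻¹])).comp (coactionHom q))
        = AlgHom.id k (OqSU2 q) := by
      apply RingQuot.ringQuot_ext'
      apply FreeAlgebra.hom_ext
      funext x
      change Algebra.TensorProduct.rid k k (OqSU2 q)
        (Algebra.TensorProduct.map (AlgHom.id k (OqSU2 q))
          (Bialgebra.counitAlgHom k k[T;T⁻¹]) (coactionHom q (gen q x))) = gen q x
      simp [coactionHom_gen]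
    exact LinearMap.ext fun a => DFunLike.congr_fun h a

/-- The standard Podleś sphere `O_q(S²)`, the coinvariants of the `U(1)`-coaction. -/
abbrev podlesSphere : Subalgebra k (OqSU2 q) := (coaction q).coinvariants

end OqSU2

end

/-!
A coaction of `k[t, t⁻¹]` on `A` is the same thing as a `ℤ`-grading: the coefficients of `δ a`
with respect to the powers of `t` are homogeneous by coassociativity
(`RightCoaction.proj_mem_component`), and they sum to `a` by counitality
(`RightCoaction.iSup_component`).

The whole theorem rests on resolving the unit: for every `n` there are finitely many `xᵢ ∈ A₋ₙ` and
`yᵢ ∈ Aₙ` with `∑ xᵢ yᵢ = 1` (`RightCoaction.UnitResolution`). In `O_q(SU(2))` the two sphere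
relations `α*α + γ*γ = 1` and `αα* + q²γγ* = 1` are such resolutions for `n = 1` and `n = -1`, and
resolutions multiply, since `∑ xᵢ (∑ x'ⱼ y'ⱼ) yᵢ = 1`; see
`OqSU2.one_mem_component_mul_component`. No basis of `O_q(SU(2))` is needed.

Given such resolutions, for `a ∈ A` and every `n` the identity `a = ∑ (a xᵢ) yᵢ` yields

* the strong grading (`RightCoaction.component_mul_component`);
* the splitting `a ↦ ∑ a xᵢ ⊗ yᵢ` for `a ∈ Aₙ`, whose left factors lie in `A₀ = B`
  (`RightCoaction.UnitResolution.isSplitting_splitting`);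
* the inverse `a ⊗ tⁿ ↦ ∑ a xᵢ ⊗ yᵢ` of the canonical map
  (`RightCoaction.UnitResolution.isHopfGalois`).
-/

open scoped TensorProduct LaurentPolynomial

noncomputable section

/-! ### Tensor products with Laurent polynomials -/

namespace LaurentPolynomial

variable {k A : Type*} [Field k] [AddCommGroup A] [Module k A]

variable (k A) in
/-- `A ⊗ k[t, t⁻¹]` as finitely supported families of elements of `A`: the coefficients of a
tensor with respect to the powers of `t`. -/
def tensorCoeff : A ⊗[k] k[T;T⁻¹] ≃ₗ[k] ℤ →₀ A :=
  TensorProduct.equivFinsuppOfBasisRight (AddMonoidAlgebra.basis ℤ k)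

theorem tensorCoeff_tmul_T (a : A) (n : ℤ) :
    tensorCoeff k A (a ⊗ₜ T n) = Finsupp.single n a := by
  ext m
  rw [tensorCoeff, TensorProduct.equivFinsuppOfBasisRight_apply_tmul, T,
    ← AddMonoidAlgebra.basis_apply, Module.Basis.repr_self]
  simp [Finsupp.single_apply]

theorem tensorCoeff_symm_apply (f : ℤ →₀ A) :
    (tensorCoeff k A).symm f = f.sum fun n a => a ⊗ₜ T n :=
  TensorProduct.equivFinsuppOfBasisRight_symm_apply _ f

theorem tensor_hom_ext {M : Type*} [AddCommGroup M] [Module k M]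
    {f g : A ⊗[k] k[T;T⁻¹] →ₗ[k] M} (h : ∀ a n, f (a ⊗ₜ T n) = g (a ⊗ₜ T n)) : f = g :=
  TensorProduct.ext <| LinearMap.ext fun a => (AddMonoidAlgebra.basis ℤ k).ext fun n => h a n

theorem bijective_antipode :
    Function.Bijective (HopfAlgebra.antipode k : k[T;T⁻¹] →ₗ[k] k[T;T⁻¹]) := by
  have h : (HopfAlgebra.antipode k : k[T;T⁻¹] →ₗ[k] k[T;T⁻¹]) ∘ₗ HopfAlgebra.antipode k
      = LinearMap.id := (AddMonoidAlgebra.basis ℤ k).ext fun n => by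
      rw [AddMonoidAlgebra.basis_apply, ← T]
      simp
  exact Function.Involutive.bijective (LinearMap.congr_fun h)

end LaurentPolynomial

/-! ### The grading defined by a coaction of `k[t, t⁻¹]` -/

namespace RightCoaction

open LaurentPolynomial

variable {k A : Type*} [Field k] [Ring A] [Algebra k A] (c : RightCoaction k A k[T;T⁻¹])

/-- The projection of `A` onto the degree `n` component: the coefficient of `tⁿ` in `δ a`. -/
def proj (n : ℤ) : A →ₗ[k] A :=
  Finsupp.lapply n ∘ₗ (tensorCoeff k A).toLinearMap ∘ₗ c.δ.toLinearMap

variable {c} in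
theorem proj_of_mem {n : ℤ} {a : A} (ha : a ∈ c.component n) (m : ℤ) :
    c.proj m a = if n = m then a else 0 := by
  simp [proj, (c.mem_component n a).1 ha, tensorCoeff_tmul_T, Finsupp.single_apply]

/-- Coassociativity makes the coefficients of `δ a` homogeneous: compare the coefficients of `tⁿ`
in the last tensor factor of `(δ ⊗ id) (δ a) = (id ⊗ Δ) (δ a)`. -/
theorem proj_mem_component (n : ℤ) (a : A) : c.proj n a ∈ c.component n := by
  -- `E` extracts the coefficient of `tⁿ` in the last tensor factor.
  let E : A ⊗[k] (k[T;T⁻¹] ⊗[k] k[T;T⁻¹]) →ₗ[k] A ⊗[k] k[T;T⁻¹] :=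
    LinearMap.lTensor A (Finsupp.lapply n ∘ₗ (tensorCoeff k k[T;T⁻¹]).toLinearMap)
  have h₁ : E ∘ₗ (TensorProduct.assoc k A k[T;T⁻¹] k[T;T⁻¹]).toLinearMap ∘ₗ
      c.δ.toLinearMap.rTensor k[T;T⁻¹]
      = c.δ.toLinearMap ∘ₗ Finsupp.lapply n ∘ₗ (tensorCoeff k A).toLinearMap := by
    refine tensor_hom_ext fun a m => ?_
    suffices h : ∀ z : A ⊗[k] k[T;T⁻¹], E (TensorProduct.assoc k A k[T;T⁻¹] k[T;T⁻¹] (z ⊗ₜ T m))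
        = if m = n then z else 0 by
      simp [h, tensorCoeff_tmul_T, Finsupp.single_apply, apply_ite c.δ]
    intro z
    induction z with
    | zero => simp
    | tmul b p =>
      simp [E, tensorCoeff_tmul_T, Finsupp.single_apply, apply_ite (fun p => b ⊗ₜ[k] p)]
    | add z w hz hw => rw [TensorProduct.add_tmul, map_add, map_add, hz, hw]; split_ifs <;> simp
  have h₂ : E ∘ₗ (Coalgebra.comul (R := k) (A := k[T;T⁻¹])).lTensor A
      = (TensorProduct.mk k A k[T;T⁻¹]).flip (T n) ∘ₗ Finsupp.lapply n ∘ₗ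
        (tensorCoeff k A).toLinearMap := by
    refine tensor_hom_ext fun a m => ?_
    simp only [E, LinearMap.comp_apply, LinearMap.lTensor_tmul, comul_T,
      LinearEquiv.coe_coe, tensorCoeff_tmul_T, Finsupp.lapply_apply, Finsupp.single_apply,
      LinearMap.flip_apply, TensorProduct.mk_apply]
    split_ifs with h <;> simp [h]
  exact (LinearMap.congr_fun h₁ (c.δ a)).symm.trans
    ((congrArg E (LinearMap.congr_fun c.coassoc a)).trans (LinearMap.congr_fun h₂ (c.δ a)))

/-- Applying the counit to `δ a = ∑ aₙ ⊗ tⁿ` gives `a = ∑ aₙ`. -/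
theorem iSup_component : ⨆ n, c.component n = ⊤ := by
  refine eq_top_iff.2 fun a _ => ?_
  have h := LinearMap.congr_fun c.counit a
  simp only [LinearMap.comp_apply, LinearMap.id_apply] at h
  rw [← h, AlgHom.toLinearMap_apply, ← (tensorCoeff k A).symm_apply_apply (c.δ a),
    tensorCoeff_symm_apply, Finsupp.sum, map_sum, map_sum]
  refine Submodule.sum_mem _ fun n _ => Submodule.mem_iSup_of_mem n ?_
  simpa [proj] using c.proj_mem_component n a

theorem isInternal_component : DirectSum.IsInternal c.component := by
  refine DirectSum.isInternal_submodule_of_iSupIndep_of_iSup_eq_top ?_ c.iSup_component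
  refine fun n => Submodule.disjoint_def.2 fun a ha ha' => ?_
  have hker : ⨆ m ≠ n, c.component m ≤ LinearMap.ker (c.proj n) :=
    iSup₂_le fun m hm b hb => by simp [proj_of_mem hb, hm]
  simpa [proj_of_mem ha] using hker ha'

theorem component_hom_ext {M : Type*} [AddCommGroup M] [Module k M] {f g : A →ₗ[k] M}
    (h : ∀ n, ∀ a ∈ c.component n, f a = g a) : f = g := by
  have : ⨆ n, c.component n ≤ LinearMap.eqLocus f g := iSup_le h
  rw [iSup_component] at this
  exact LinearMap.ext fun a => this trivial

theorem mul_mem_component {m n : ℤ} {a b : A} (ha : a ∈ c.component m) (hb : b ∈ c.component n) :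
    a * b ∈ c.component (m + n) := by
  rw [mem_component] at *
  rw [map_mul, ha, hb, Algebra.TensorProduct.tmul_mul_tmul, T_add]

theorem component_mul_component_le (m n : ℤ) :
    c.component m * c.component n ≤ c.component (m + n) :=
  Submodule.mul_le.2 fun _ ha _ hb => c.mul_mem_component ha hb

/-- A resolution of the unit in degrees `-n` and `n` makes the grading strong at `n`, because
`a = ∑ (a xᵢ) yᵢ`. -/
theorem component_mul_component (h : ∀ n, 1 ∈ c.component (-n) * c.component n) (m n : ℤ) :
    c.component m * c.component n = c.component (m + n) := by
  refine (c.component_mul_component_le m n).antisymm ?_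
  calc c.component (m + n) = c.component (m + n) * 1 := (mul_one _).symm
    _ ≤ c.component (m + n) * (c.component (-n) * c.component n) :=
      mul_le_mul_right (Submodule.one_le.2 (h n)) _
    _ = c.component (m + n) * c.component (-n) * c.component n := (mul_assoc _ _ _).symm
    _ ≤ c.component m * c.component n := by
      refine mul_le_mul_left ((c.component_mul_component_le _ _).trans_eq ?_) _
      rw [add_neg_cancel_right]

theorem one_mem_component_zero : (1 : A) ∈ c.component 0 := c.coinvariants.one_mem

/-- It suffices to resolve the unit in degrees `1` and `-1`: resolutions multiply, inserting one
into the middle of the other. -/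
theorem one_mem_component_mul_component (h₁ : 1 ∈ c.component (-1) * c.component 1)
    (h₂ : 1 ∈ c.component 1 * c.component (-1)) (n : ℤ) :
    1 ∈ c.component (-n) * c.component n := by
  have step : ∀ m e : ℤ, 1 ∈ c.component (-e) * c.component e →
      1 ∈ c.component (-m) * c.component m →
      1 ∈ c.component (-(m + e)) * c.component (m + e) := by
    intro m e he hm
    rw [← Submodule.one_le] at *
    calc (1 : Submodule k A) ≤ c.component (-e) * 1 * c.component e := by rwa [mul_one]
      _ ≤ c.component (-e) * (c.component (-m) * c.component m) * c.component e :=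
        mul_le_mul_left (mul_le_mul_right hm _) _
      _ = (c.component (-e) * c.component (-m)) * (c.component m * c.component e) := by
        simp only [mul_assoc]
      _ ≤ _ := mul_le_mul' ((c.component_mul_component_le _ _).trans_eq (by rw [neg_add_rev]))
        (c.component_mul_component_le _ _)
  induction n with
  | zero => simpa using Submodule.mul_mem_mul c.one_mem_component_zero c.one_mem_component_zero
  | succ n ih => exact step _ _ h₁ ih
  | pred n ih => exact step _ (-1) (by simpa using h₂) ih

end RightCoaction

/-! ### Resolutions of the unit, the splitting and the canonical map -/

namespace RightCoaction

open LaurentPolynomial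

variable {k A : Type*} [Field k] [Ring A] [Algebra k A] (c : RightCoaction k A k[T;T⁻¹])

/-- A choice, for every degree `n`, of finitely many `xᵢ ∈ A₋ₙ` and `yᵢ ∈ Aₙ` with
`∑ xᵢ yᵢ = 1`. -/
structure UnitResolution where
  /-- the number of summands in degree `n` -/
  size : ℤ → ℕ
  /-- the left factors `xᵢ` -/
  x (n : ℤ) : Fin (size n) → A
  /-- the right factors `yᵢ` -/
  y (n : ℤ) : Fin (size n) → A
  x_mem (n : ℤ) (i : Fin (size n)) : x n i ∈ c.component (-n)
  y_mem (n : ℤ) (i : Fin (size n)) : y n i ∈ c.component n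
  sum_mul (n : ℤ) : ∑ i, x n i * y n i = 1

variable {c} in
theorem nonempty_unitResolution (h : ∀ n, 1 ∈ c.component (-n) * c.component n) :
    Nonempty c.UnitResolution := by
  have key : ∀ n, ∃ (N : ℕ) (x y : Fin N → A), (∀ i, x i ∈ c.component (-n)) ∧
      (∀ i, y i ∈ c.component n) ∧ ∑ i, x i * y i = 1 := by
    intro n
    obtain ⟨z, hz⟩ : 1 ∈ LinearMap.range (Submodule.mulMap (c.component (-n)) (c.component n)) := by
      rw [Submodule.mulMap_range]
      exact h n
    obtain ⟨S, rfl⟩ := TensorProduct.exists_finset z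
    refine ⟨S.card, fun i => (S.equivFin.symm i).1.1, fun i => (S.equivFin.symm i).1.2,
      fun i => (S.equivFin.symm i).1.1.2, fun i => (S.equivFin.symm i).1.2.2, ?_⟩
    rw [S.equivFin.symm.sum_comp fun p => (p.1.1 * p.1.2 : A), ← hz, map_sum,
      S.sum_coe_sort fun p => (p.1 * p.2 : A)]
    rfl
  choose N x y hx hy hxy using key
  exact ⟨⟨N, x, y, hx, hy, hxy⟩⟩

/-- The projection of `A` onto the coinvariants `B = A₀`. -/
def projZero : A →ₗ[k] c.coinvariants :=
  (c.proj 0).codRestrict c.coinvariants.toSubmodule (c.proj_mem_component 0)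

variable {c}

theorem coe_projZero_of_mem {a : A} (ha : a ∈ c.component 0) : (c.projZero a : A) = a :=
  (proj_of_mem ha 0).trans (if_pos rfl)

namespace UnitResolution

variable (r : c.UnitResolution)

theorem mul_x_mem {n : ℤ} {a : A} (ha : a ∈ c.component n) (i : Fin (r.size n)) :
    a * r.x n i ∈ c.component 0 := by
  simpa using c.mul_mem_component ha (r.x_mem n i)

theorem sum_mul_x_mul_y (n : ℤ) (a : A) : ∑ i, a * r.x n i * r.y n i = a := by
  simp only [mul_assoc, ← Finset.mul_sum, r.sum_mul, mul_one]

/-- The splitting `a ↦ ∑ a xᵢ ⊗ yᵢ` for `a ∈ Aₙ`, extended linearly to `A`. The factors `a xᵢ` lie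
in `B = A₀`; applying `projZero` to them makes the formula meaningful for every `a`. -/
def splitting : A →ₗ[k] c.coinvariants ⊗[k] A :=
  Finsupp.lsum k (fun n => ∑ i, (TensorProduct.mk k c.coinvariants A).flip (r.y n i) ∘ₗ
    c.projZero ∘ₗ LinearMap.mulRight k (r.x n i)) ∘ₗ
    (tensorCoeff k A).toLinearMap ∘ₗ c.δ.toLinearMap

theorem splitting_of_mem {n : ℤ} {a : A} (ha : a ∈ c.component n) :
    r.splitting a = ∑ i, c.projZero (a * r.x n i) ⊗ₜ r.y n i := by
  simp [splitting, (c.mem_component n a).1 ha, tensorCoeff_tmul_T]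

theorem val_rTensor_splitting {n : ℤ} {a : A} (ha : a ∈ c.component n) :
    c.coinvariants.val.toLinearMap.rTensor A (r.splitting a)
      = ∑ i, (a * r.x n i) ⊗ₜ[k] r.y n i := by
  rw [r.splitting_of_mem ha, map_sum]
  refine Finset.sum_congr rfl fun i _ => ?_
  rw [LinearMap.rTensor_tmul]
  exact congr($(coe_projZero_of_mem (r.mul_x_mem ha i)) ⊗ₜ _)

theorem isSplitting_splitting : c.IsSplitting r.splitting where
  left_linear b := by
    have hb : (b : A) ∈ c.component 0 := b.2
    suffices h : r.splitting ∘ₗ LinearMap.mulLeft k (b : A)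
        = DistribSMul.toLinearMap k (c.coinvariants ⊗[k] A) b ∘ₗ r.splitting from LinearMap.congr_fun h
    refine c.component_hom_ext fun n a ha => ?_
    have hba : (b : A) * a ∈ c.component n := by simpa using c.mul_mem_component hb ha
    rw [LinearMap.comp_apply, LinearMap.comp_apply, LinearMap.mulLeft_apply,
      r.splitting_of_mem hba, r.splitting_of_mem ha, DistribSMul.toLinearMap_apply,
      Finset.smul_sum]
    refine Finset.sum_congr rfl fun i _ => ?_
    rw [TensorProduct.smul_tmul']
    congr 1
    refine Subtype.ext ?_
    rw [coe_projZero_of_mem (r.mul_x_mem hba i), smul_eq_mul, Subalgebra.coe_mul,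
      coe_projZero_of_mem (r.mul_x_mem ha i), mul_assoc]
  right_colinear := by
    refine c.component_hom_ext fun n a ha => ?_
    simp only [LinearMap.comp_apply, AlgHom.toLinearMap_apply, (c.mem_component n a).1 ha,
      LinearMap.rTensor_tmul, r.splitting_of_mem ha, map_sum, TensorProduct.sum_tmul,
      LinearMap.lTensor_tmul, LinearEquiv.coe_coe, TensorProduct.assoc_tmul]
    exact Finset.sum_congr rfl fun i _ => by rw [(c.mem_component n _).1 (r.y_mem n i)]
  mul_comp := by
    refine c.component_hom_ext fun n a ha => ?_
    rw [LinearMap.comp_apply, r.splitting_of_mem ha, map_sum]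
    refine (Finset.sum_congr rfl fun i _ => ?_).trans (r.sum_mul_x_mul_y n a)
    exact congr($(coe_projZero_of_mem (r.mul_x_mem ha i)) * _)

/-- The inverse `a ⊗ tⁿ ↦ ∑ a xᵢ ⊗ yᵢ` of the canonical map. -/
def canInv : A ⊗[k] k[T;T⁻¹] →ₗ[k] BalancedTensor c.coinvariants :=
  Finsupp.lsum k (fun n => ∑ i, (balancedRelations c.coinvariants).mkQ ∘ₗ
    (TensorProduct.mk k A A).flip (r.y n i) ∘ₗ LinearMap.mulRight k (r.x n i)) ∘ₗ
    (tensorCoeff k A).toLinearMap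

theorem canInv_tmul_T (a : A) (n : ℤ) :
    r.canInv (a ⊗ₜ T n)
      = ∑ i, (balancedRelations c.coinvariants).mkQ ((a * r.x n i) ⊗ₜ r.y n i) := by
  simp [canInv, tensorCoeff_tmul_T]

theorem canLift_tmul_of_mem (a : A) {n : ℤ} {b : A} (hb : b ∈ c.component n) :
    c.canLift (a ⊗ₜ b) = (a * b) ⊗ₜ T n := by
  rw [canLift_tmul, (c.mem_component n b).1 hb, Algebra.TensorProduct.tmul_mul_tmul, one_mul]

theorem can_comp_canInv : c.can ∘ₗ r.canInv = LinearMap.id := by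
  refine tensor_hom_ext fun a n => ?_
  rw [LinearMap.comp_apply, r.canInv_tmul_T, map_sum]
  simp_rw [can, Submodule.mkQ_apply, Submodule.liftQ_apply, canLift_tmul_of_mem _ (r.y_mem n _),
    ← TensorProduct.sum_tmul, r.sum_mul_x_mul_y, LinearMap.id_apply]

/-- For `b` of degree `n` the products `b xᵢ` are coinvariant, so they move across `⊗_B`:
`∑ a b xᵢ ⊗ yᵢ = ∑ a ⊗ b xᵢ yᵢ = a ⊗ b`. -/
theorem canInv_comp_can : r.canInv ∘ₗ c.can = LinearMap.id := by
  refine Submodule.linearMap_qext _ (TensorProduct.ext <| LinearMap.ext fun a =>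
    c.component_hom_ext fun n b hb => ?_)
  change r.canInv (c.canLift (a ⊗ₜ b)) = (balancedRelations c.coinvariants).mkQ (a ⊗ₜ b)
  rw [canLift_tmul_of_mem a hb, r.canInv_tmul_T]
  have h : ∀ i, (balancedRelations c.coinvariants).mkQ ((a * b * r.x n i) ⊗ₜ r.y n i)
      = (balancedRelations c.coinvariants).mkQ (a ⊗ₜ (b * r.x n i * r.y n i)) := fun i =>
    (Submodule.Quotient.eq _).2 <| Submodule.subset_span
      ⟨a, r.y n i, ⟨b * r.x n i, r.mul_x_mem hb i⟩, by rw [mul_assoc]⟩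
  simp_rw [h, ← map_sum, ← TensorProduct.tmul_sum, r.sum_mul_x_mul_y]

theorem isHopfGalois (r : c.UnitResolution) : c.IsHopfGalois :=
  Function.bijective_iff_has_inverse.2
    ⟨r.canInv, LinearMap.congr_fun r.canInv_comp_can, LinearMap.congr_fun r.can_comp_canInv⟩

theorem isPrincipal (r : c.UnitResolution) : c.IsPrincipal where
  antipode_bijective := bijective_antipode
  hopfGalois := r.isHopfGalois
  exists_splitting := ⟨r.splitting, r.isSplitting_splitting⟩

end UnitResolution

end RightCoaction

/-! ### The sphere relations in `O_q(SU(2))` -/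

namespace OqSU2

variable {k : Type*} [Field k] (q : k)

theorem gen_mem_component (g : SUqGen) : gen q g ∈ (coaction q).component g.weight :=
  coactionHom_gen q g

theorem aStar_mul_a_add_cStar_mul_c :
    gen q .aStar * gen q .a + gen q .cStar * gen q .c = 1 := by
  simpa [gen] using RingQuot.mkAlgHom_rel k (SUqRel.sphere_left (q := q))

theorem a_mul_aStar_add_c_mul_cStar :
    gen q .a * gen q .aStar + q ^ 2 • (gen q .c * gen q .cStar) = 1 := by
  simpa [gen] using RingQuot.mkAlgHom_rel k (SUqRel.sphere_right (q := q))

/-- The two sphere relations resolve the unit in degrees `1` and `-1`. -/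
theorem one_mem_component_mul_component (n : ℤ) :
    1 ∈ (coaction q).component (-n) * (coaction q).component n := by
  refine (coaction q).one_mem_component_mul_component ?_ ?_ n
  · rw [← aStar_mul_a_add_cStar_mul_c q]
    exact add_mem (Submodule.mul_mem_mul (gen_mem_component q .aStar) (gen_mem_component q .a))
      (Submodule.mul_mem_mul (gen_mem_component q .cStar) (gen_mem_component q .c))
  · rw [← a_mul_aStar_add_c_mul_cStar q]
    exact add_mem (Submodule.mul_mem_mul (gen_mem_component q .a) (gen_mem_component q .aStar))
      (Submodule.smul_mem _ _
        (Submodule.mul_mem_mul (gen_mem_component q .c) (gen_mem_component q .cStar)))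

end OqSU2

end

theorem mainTheorem6 {k : Type*} [Field k] (q : k) (hq : q ≠ 0) :
    (OqSU2.coaction q).IsPrincipal ∧
    DirectSum.IsInternal (OqSU2.coaction q).component ∧
    (∀ m n : ℤ, (OqSU2.coaction q).component m * (OqSU2.coaction q).component n =
      (OqSU2.coaction q).component (m + n)) ∧
    ∃ s : OqSU2 q →ₗ[k] OqSU2.podlesSphere q ⊗[k] OqSU2 q,
      (OqSU2.coaction q).IsSplitting s ∧
      ∀ n : ℤ, ∃ (N : ℕ) (x y : Fin N → OqSU2 q),
        (∀ i, x i ∈ (OqSU2.coaction q).component (-n)) ∧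
        (∀ i, y i ∈ (OqSU2.coaction q).component n) ∧
        ∑ i, x i * y i = 1 ∧
        ∀ a ∈ (OqSU2.coaction q).component n,
          (OqSU2.podlesSphere q).val.toLinearMap.rTensor (OqSU2 q) (s a) =
            ∑ i, (a * x i) ⊗ₜ[k] y i := by
  have h := OqSU2.one_mem_component_mul_component q
  obtain ⟨r⟩ := RightCoaction.nonempty_unitResolution h
  exact ⟨r.isPrincipal, (OqSU2.coaction q).isInternal_component,
    (OqSU2.coaction q).component_mul_component h, r.splitting, r.isSplitting_splitting,
    fun n => ⟨r.size n, r.x n, r.y n, r.x_mem n, r.y_mem n, r.sum_mul n,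
      fun a ha => r.val_rTensor_splitting ha⟩⟩
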